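/- **Theorem (Hyperbolic ping-pong).** Let $X$ be a geodesic metric space that is hyperbolic in the sense of Gromov: there is $\delta>0$ such that each side of any geodesic triangle in $X$ is contained in the $\delta$-neighbourhood of the union of the other two sides. A map $f:Y\to X$ of metric spaces is a *quasi-isometric embedding* if there are $L\ge1$, $A\ge0$ with $L^{-1}d(s,t)-A\le d(f(s),f(t))\le L\,d(s,t)+A$ for all $s,t\in Y$. Let $\partial X$ be the set of quasigeodesic rays $[0,\infty)\to X$ (quasi-isometric embeddings, not necessarily continuous), two rays being identified when their images have finite Hausdorff distance; isometries of $X$ act on $\partial X$ by composition. Call an isometry $\phi$ of $X$ (onto itself) *hyperbolic* if for some $x\in X$ the map $\mathbb Z\to X$, $n\mapsto\phi^n(x)$, is a quasi-isometric embedding. Let $K\ge 0$ and let $\phi_1,\dots,\phi_K$ be hyperbolic isometries of $X$ whose fixed point sets in $\partial X$ are pairwise disjoint. Then there exists an integer $B\ge 1$ such that for all integers $\beta_1,\dots,\beta_K\ge B$ the isometries $\phi_1^{\beta_1},\dots,\phi_K^{\beta_K}$ freely generate a convex cocompact group $G$ of isometries of $X$. That is, the homomorphism from the free group on $K$ generators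 to the isometry group of $X$ sending the $i$-th generator to $\phi_i^{\beta_i}$ is injective, and its image $G$, the group generated by the $\phi_i^{\beta_i}$, has the following properties: $G$ is finitely generated; $G$ is discrete, in the sense that for all $p\in X$ and $r\in\mathbb R$ only finitely many $g\in G$ satisfy $d(p,gp)\le r$; and every orbit $G\cdot p$ is quasiconvex, i.e. there is a constant $C$ such that every point of every geodesic of $X$ with both endpoints in $G\cdot p$ lies within distance $C$ of $G\cdot p$. -/

import Mathlib

open scoped NNReal

namespace CoarseGeometry

/-- `S` is the image of a geodesic from `x` to `y`, that is, of an isometrically embedded path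
`[0, d(x, y)] → X` starting at `x` and ending at `y`. -/
def IsGeodesicSegment {X : Type*} [MetricSpace X] (S : Set X) (x y : X) : Prop :=
  ∃ γ : ℝ → X, γ 0 = x ∧ γ (dist x y) = y ∧
    (∀ s ∈ Set.Icc 0 (dist x y), ∀ t ∈ Set.Icc 0 (dist x y), dist (γ s) (γ t) = |s - t|) ∧
    S = γ '' Set.Icc 0 (dist x y)

/-- Any two points are joined by a geodesic. -/
def IsGeodesicSpace (X : Type*) [MetricSpace X] : Prop :=
  ∀ x y : X, ∃ S : Set X, IsGeodesicSegment S x y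

/-- Gromov hyperbolicity: for some `δ > 0`, each side of any geodesic triangle lies in the
`δ`-neighbourhood of the union of the other two sides. -/
def IsGromovHyperbolic (X : Type*) [MetricSpace X] : Prop :=
  ∃ δ : ℝ, 0 < δ ∧ ∀ (x y z : X) (a b c : Set X),
    IsGeodesicSegment a x y → IsGeodesicSegment b y z → IsGeodesicSegment c z x →
      a ⊆ Metric.thickening δ (b ∪ c)

/-- Quasi-isometric embeddings (not necessarily continuous). -/
def IsQuasiIsometricEmbedding {Y X : Type*} [MetricSpace Y] [MetricSpace X] (f : Y → X) : Prop :=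
  ∃ L A : ℝ, 1 ≤ L ∧ 0 ≤ A ∧ ∀ s t : Y,
    L⁻¹ * dist s t - A ≤ dist (f s) (f t) ∧ dist (f s) (f t) ≤ L * dist s t + A

/-- Quasigeodesic rays `[0, ∞) → X`. -/
def QuasigeodesicRay (X : Type*) [MetricSpace X] : Type _ :=
  {ρ : ℝ≥0 → X // IsQuasiIsometricEmbedding ρ}

/-- Two quasigeodesic rays are equivalent if their images are at finite Hausdorff distance. -/
instance quasigeodesicRaySetoid (X : Type*) [MetricSpace X] : Setoid (QuasigeodesicRay X) where
  r ρ σ := Metric.hausdorffEDist (Set.range ρ.1) (Set.range σ.1) < ⊤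
  iseqv :=
    { refl := fun ρ => by simp
      symm := fun {ρ σ} h => by rwa [Metric.hausdorffEDist_comm]
      trans := fun {ρ σ τ} h k =>
        lt_of_le_of_lt Metric.hausdorffEDist_triangle (ENNReal.add_lt_top.2 ⟨h, k⟩) }

/-- The boundary `∂X`: quasigeodesic rays modulo finite Hausdorff distance. -/
def GromovBoundary (X : Type*) [MetricSpace X] : Type _ :=
  Quotient (quasigeodesicRaySetoid X)

/-- The image of a quasigeodesic ray under an isometry. -/
def QuasigeodesicRay.map {X : Type*} [MetricSpace X] (φ : X ≃ᵢ X) (ρ : QuasigeodesicRay X) :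
    QuasigeodesicRay X :=
  ⟨fun t => φ (ρ.1 t), by
    obtain ⟨L, A, hL, hA, h⟩ := ρ.2
    exact ⟨L, A, hL, hA, fun s t => by simpa only [φ.dist_eq] using h s t⟩⟩

/-- The map `∂X → ∂X` induced by an isometry, `[ρ] ↦ [φ ∘ ρ]`. -/
def GromovBoundary.map {X : Type*} [MetricSpace X] (φ : X ≃ᵢ X) :
    GromovBoundary X → GromovBoundary X :=
  Quotient.map (QuasigeodesicRay.map φ) (by
    intro ρ σ h
    change Metric.hausdorffEDist (Set.range (φ ∘ ρ.1)) (Set.range (φ ∘ σ.1)) < ⊤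
    rw [Set.range_comp, Set.range_comp, Metric.hausdorffEDist_image φ.isometry]
    exact h)

/-- The set of fixed points in `∂X` of an isometry of `X`. -/
def boundaryFixedPoints {X : Type*} [MetricSpace X] (φ : X ≃ᵢ X) : Set (GromovBoundary X) :=
  Function.fixedPoints (GromovBoundary.map φ)

/-- An isometry is hyperbolic (loxodromic) if its orbit map `ℤ → X`, `n ↦ φⁿ x`, is a
quasi-isometric embedding; this does not depend on `x`. -/
def IsHyperbolicIsometry {X : Type*} [MetricSpace X] (φ : X ≃ᵢ X) : Prop :=
  ∃ x : X, IsQuasiIsometricEmbedding (fun n : ℤ => (φ ^ n) x)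

/-- `S` is quasiconvex: for some `C`, every geodesic with endpoints in `S` stays within
distance `C` of `S`. -/
def IsQuasiconvex {X : Type*} [MetricSpace X] (S : Set X) : Prop :=
  ∃ C : ℝ, ∀ x ∈ S, ∀ y ∈ S, ∀ T : Set X, IsGeodesicSegment T x y →
    ∀ z ∈ T, ∃ w ∈ S, dist z w ≤ C

/-- A group `G` of isometries is convex cocompact if it is finitely generated, discrete (only
finitely many elements move a given point by a bounded amount), and its orbits are
quasiconvex. -/
structure IsConvexCocompact {X : Type*} [MetricSpace X] (G : Subgroup (X ≃ᵢ X)) : Prop where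
  fg : G.FG
  discrete : ∀ (p : X) (r : ℝ), {g : X ≃ᵢ X | g ∈ G ∧ dist p (g p) ≤ r}.Finite
  quasiconvex : ∀ p : X, IsQuasiconvex ((fun g : X ≃ᵢ X => g p) '' (G : Set (X ≃ᵢ X)))

end CoarseGeometry

/-! In a hyperbolic space, a broken geodesic with long pieces and small Gromov products at its
corners is globally quasigeodesic (`mul_le_dist_of_local`) and the product of its endpoints at each
corner is bounded (`gromovProduct_le_of_local`). Fix a base point `o`. A reduced word in the `φ i ^
β i` traces such a path through the translates of `o` by its prefixes, whose corners compare two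
distinct letters. The Gromov products of the orbits of distinct letters are bounded uniformly in the
exponents: opposite letters give the two ends of one axis (`exists_gromovProduct_inv_pow_le`); for
different generators, unbounded products would produce a common fixed point at infinity
(`exists_gromovProduct_pow_pow_le`). Raising the exponents therefore lengthens the pieces without
worsening the corners. Linear growth in word length gives freeness and discreteness; bounded
products at the corners give quasiconvexity. -/

namespace CoarseGeometry

variable {X : Type*} [MetricSpace X]

/-! ### Gromov products and slim triangles -/

/-- The Gromov product of `x` and `y` based at `w`. -/
noncomputable def gromovProduct (w x y : X) : ℝ := (dist w x + dist w y - dist x y) / 2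

/-- Gromov's four-point condition with constant `δ`. -/
def FourPointCondition (X : Type*) [MetricSpace X] (δ : ℝ) : Prop :=
  ∀ w x y z : X, min (gromovProduct w x y) (gromovProduct w y z) - δ ≤ gromovProduct w x z

lemma gromovProduct_comm (w x y : X) : gromovProduct w x y = gromovProduct w y x := by
  simp only [gromovProduct, dist_comm x y]; ring

lemma gromovProduct_nonneg (w x y : X) : 0 ≤ gromovProduct w x y := by
  have := dist_triangle_left x y w
  simp only [gromovProduct]; linarith

lemma gromovProduct_self_left (w x : X) : gromovProduct w w x = 0 := by
  simp [gromovProduct]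

lemma gromovProduct_le_dist_left (w x y : X) : gromovProduct w x y ≤ dist w x := by
  have := dist_triangle w x y
  simp only [gromovProduct]; linarith

lemma gromovProduct_le_dist_right (w x y : X) : gromovProduct w x y ≤ dist w y := by
  rw [gromovProduct_comm]; exact gromovProduct_le_dist_left w y x

lemma gromovProduct_add_gromovProduct (w x y : X) :
    gromovProduct w x y + gromovProduct x w y = dist w x := by
  simp only [gromovProduct, dist_comm x w]; ring

lemma dist_eq_sub_gromovProduct (w x y : X) :
    dist x y = dist w x + dist w y - 2 * gromovProduct w x y := by
  simp only [gromovProduct]; ring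

lemma gromovProduct_isometryEquiv (g : X ≃ᵢ X) (w x y : X) :
    gromovProduct (g w) (g x) (g y) = gromovProduct w x y := by
  simp only [gromovProduct, g.dist_eq]

/-- The Gromov product changes by a bounded amount when its arguments do. -/
lemma gromovProduct_le_of_dist_le {w x y w' x' y' : X} {r : ℝ} (hw : dist w w' ≤ r)
    (hx : dist x x' ≤ r) (hy : dist y y' ≤ r) :
    gromovProduct w x y ≤ gromovProduct w' x' y' + 3 * r := by
  have h1 := dist_triangle4 w w' x' x
  have h2 := dist_triangle4 w w' y' y
  have h3 := dist_triangle4 x' x y y'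
  rw [dist_comm x' x] at h1 h3
  rw [dist_comm y' y] at h2
  simp only [gromovProduct]; linarith

lemma IsGeodesicSegment.left_mem {S : Set X} {x y : X} (h : IsGeodesicSegment S x y) : x ∈ S := by
  obtain ⟨γ, h0, -, -, rfl⟩ := h
  exact ⟨0, ⟨le_rfl, dist_nonneg⟩, h0⟩

lemma IsGeodesicSegment.right_mem {S : Set X} {x y : X} (h : IsGeodesicSegment S x y) :
    y ∈ S := by
  obtain ⟨γ, -, h1, -, rfl⟩ := h
  exact ⟨_, ⟨dist_nonneg, le_rfl⟩, h1⟩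

lemma IsGeodesicSegment.dist_add_dist {S : Set X} {x y p : X} (h : IsGeodesicSegment S x y)
    (hp : p ∈ S) : dist x p + dist p y = dist x y := by
  obtain ⟨γ, h0, h1, h, rfl⟩ := h
  obtain ⟨t, ht, rfl⟩ := hp
  have e0 := h 0 ⟨le_rfl, dist_nonneg⟩ t ht
  have e1 := h t ht _ ⟨dist_nonneg, le_rfl⟩
  rw [h0, abs_of_nonpos (by linarith [ht.1])] at e0
  rw [h1, abs_of_nonpos (by linarith [ht.2])] at e1
  linarith

lemma IsGeodesicSegment.isPreconnected {S : Set X} {x y : X} (h : IsGeodesicSegment S x y) :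
    IsPreconnected S := by
  obtain ⟨γ, -, -, h, rfl⟩ := h
  refine isPreconnected_Icc.image γ (LipschitzOnWith.continuousOn (K := 1) ?_)
  refine LipschitzOnWith.of_dist_le_mul fun s hs t ht => ?_
  rw [h s hs t ht, Real.dist_eq]; simp

lemma IsGeodesicSegment.gromovProduct_le_dist {S : Set X} {x y p : X}
    (h : IsGeodesicSegment S x y) (hp : p ∈ S) (w : X) : gromovProduct w x y ≤ dist w p := by
  have h1 := h.dist_add_dist hp
  have h2 := dist_triangle w p x
  have h3 := dist_triangle w p y
  rw [dist_comm p x] at h2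
  simp only [gromovProduct]; linarith

/-- In a space with `δ`-slim triangles, a geodesic from `x` to `z` comes within
`(x | z)_w + 2δ` of `w`. -/
lemma IsGeodesicSegment.exists_dist_le {δ : ℝ} (hgeo : IsGeodesicSpace X)
    (hslim : ∀ (x y z : X) (a b c : Set X),
      IsGeodesicSegment a x y → IsGeodesicSegment b y z → IsGeodesicSegment c z x →
        a ⊆ Metric.thickening δ (b ∪ c)) (hδ : 0 < δ)
    {S : Set X} {x z : X} (h : IsGeodesicSegment S x z) (w : X) :
    ∃ p ∈ S, dist w p ≤ gromovProduct w x z + 2 * δ := by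
  obtain ⟨b, hb⟩ := hgeo z w
  obtain ⟨c, hc⟩ := hgeo w x
  have hsub := hslim x z w S b c h hb hc
  rw [Metric.thickening_union] at hsub
  -- The connected side `S` is covered by two open thickenings, each containing one of its
  -- endpoints, so some point is close to both other sides.
  obtain ⟨p, hpS, hpb, hpc⟩ := h.isPreconnected _ _ Metric.isOpen_thickening
    Metric.isOpen_thickening hsub
    ⟨z, h.right_mem, Metric.self_subset_thickening hδ _ hb.left_mem⟩
    ⟨x, h.left_mem, Metric.self_subset_thickening hδ _ hc.right_mem⟩
  obtain ⟨q, hq, hpq⟩ := Metric.mem_thickening_iff.1 hpb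
  obtain ⟨r, hr, hpr⟩ := Metric.mem_thickening_iff.1 hpc
  refine ⟨p, hpS, ?_⟩
  have e1 := h.dist_add_dist hpS
  have e2 := hb.dist_add_dist hq
  have e3 := hc.dist_add_dist hr
  have t1 := dist_triangle w q p
  have t2 := dist_triangle w r p
  have t3 := dist_triangle x r p
  have t4 := dist_triangle z q p
  simp only [gromovProduct]
  rw [dist_comm q p] at t1 t4
  rw [dist_comm r p] at t2 t3
  rw [dist_comm p z] at e1
  rw [dist_comm q w, dist_comm z w] at e2
  rw [dist_comm r x] at e3
  linarith

/-- The side from `x` to `z` has a point within `(x | z)_w + 2δ` of `w`; slimness moves it by `δ`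
onto another side, all of whose points are at least the corresponding Gromov product away from `w`.
-/
lemma fourPointCondition_of_slim {δ : ℝ} (hgeo : IsGeodesicSpace X)
    (hslim : ∀ (x y z : X) (a b c : Set X),
      IsGeodesicSegment a x y → IsGeodesicSegment b y z → IsGeodesicSegment c z x →
        a ⊆ Metric.thickening δ (b ∪ c)) (hδ : 0 < δ) :
    FourPointCondition X (3 * δ) := by
  intro w x y z
  obtain ⟨a, ha⟩ := hgeo x z
  obtain ⟨b, hb⟩ := hgeo z y
  obtain ⟨c, hc⟩ := hgeo y x
  obtain ⟨p, hp, hwp⟩ := ha.exists_dist_le hgeo hslim hδ w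
  obtain ⟨q, hq, hpq⟩ := Metric.mem_thickening_iff.1 (hslim x z y a b c ha hb hc hp)
  have t := dist_triangle w p q
  rcases hq with hq | hq
  · have := hb.gromovProduct_le_dist hq w
    rw [gromovProduct_comm] at this
    linarith [min_le_right (gromovProduct w x y) (gromovProduct w y z)]
  · have := hc.gromovProduct_le_dist hq w
    rw [gromovProduct_comm] at this
    linarith [min_le_left (gromovProduct w x y) (gromovProduct w y z)]

/-! ### From local to global for broken geodesics -/

/-- By induction `x j` and `x k` have a large product seen from `x (k + 1)`, because the piece
between `x k` and `x (k + 1)` is long. If `x j` and `x (k + 2)` did too, the four-point condition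
would violate the corner bound. -/
lemma gromovProduct_succ_le {δ D R : ℝ} (hX : FourPointCondition X δ) (hδ : 0 ≤ δ) (hD : 0 ≤ D)
    (hR : 2 * D + 3 * δ < R) {n : ℕ} {x : ℕ → X}
    (hangle : ∀ k, k + 2 ≤ n → gromovProduct (x (k + 1)) (x k) (x (k + 2)) ≤ D)
    (hstep : ∀ k < n, R ≤ dist (x k) (x (k + 1))) (j : ℕ) {k : ℕ} (hjk : j ≤ k) (hkn : k < n) :
    gromovProduct (x k) (x j) (x (k + 1)) ≤ D + δ := by
  induction k, hjk using Nat.le_induction with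
  | base => rw [gromovProduct_self_left]; linarith
  | succ k hjk ih =>
    have h1 := ih (by omega)
    have h2 := gromovProduct_add_gromovProduct (x k) (x (k + 1)) (x j)
    have h3 := hstep k (by omega)
    have h4 := hangle k (by omega)
    have h5 := hX (x (k + 1)) (x k) (x j) (x (k + 2))
    rw [gromovProduct_comm] at h1
    by_contra! h
    have := lt_min (show D + δ < gromovProduct (x (k + 1)) (x k) (x j) by linarith) h
    linarith

/-- Broken geodesics with long pieces and small Gromov products at the corners are
quasigeodesic: the distance of the endpoints grows at least linearly. -/
lemma mul_le_dist_of_local {δ D R : ℝ} (hX : FourPointCondition X δ) (hδ : 0 ≤ δ) (hD : 0 ≤ D)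
    (hR : 2 * D + 3 * δ < R) {n : ℕ} {x : ℕ → X}
    (hangle : ∀ k, k + 2 ≤ n → gromovProduct (x (k + 1)) (x k) (x (k + 2)) ≤ D)
    (hstep : ∀ k < n, R ≤ dist (x k) (x (k + 1))) {m : ℕ} (hm : m ≤ n) :
    m * (R - 2 * D - 2 * δ) ≤ dist (x 0) (x m) := by
  induction m with
  | zero => simp
  | succ m ih =>
    have h1 := ih (by omega)
    have h2 := gromovProduct_succ_le hX hδ hD hR hangle hstep 0 (Nat.zero_le m) (by omega)
    have h3 := hstep m (by omega)
    rw [dist_eq_sub_gromovProduct (x m), dist_comm (x m) (x 0)]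
    push_cast
    linarith

/-- Broken geodesics with long pieces and small Gromov products at the corners pass close to
their corners. -/
lemma gromovProduct_le_of_local {δ D R : ℝ} (hX : FourPointCondition X δ) (hδ : 0 ≤ δ)
    (hD : 0 ≤ D) (hR : 2 * D + 3 * δ < R) {n : ℕ} {x : ℕ → X}
    (hangle : ∀ k, k + 2 ≤ n → gromovProduct (x (k + 1)) (x k) (x (k + 2)) ≤ D)
    (hstep : ∀ k < n, R ≤ dist (x k) (x (k + 1))) {k : ℕ} (hk : k ≤ n) :
    gromovProduct (x k) (x 0) (x n) ≤ D + 2 * δ := by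
  rcases hk.eq_or_lt with rfl | hk
  · rw [gromovProduct_comm, gromovProduct_self_left]; linarith
  have h1 := gromovProduct_succ_le hX hδ hD hR hangle hstep 0 (Nat.zero_le k) hk
  -- The reversed path bounds the product of `x n` and `x k` at `x (k + 1)`.
  have h2 := gromovProduct_succ_le hX hδ hD hR (n := n) (x := fun i => x (n - i))
    (fun i hi => by
      have := hangle (n - (i + 2)) (by omega)
      rw [gromovProduct_comm]
      rwa [show n - (i + 2) + 1 = n - (i + 1) by omega,
        show n - (i + 2) + 2 = n - i by omega] at this)
    (fun i hi => by
      have := hstep (n - (i + 1)) (by omega)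
      rwa [show n - (i + 1) + 1 = n - i by omega, dist_comm] at this)
    0 (k := n - (k + 1)) (Nat.zero_le _) (by omega)
  simp only [show n - (n - (k + 1)) = k + 1 by omega, Nat.sub_zero,
    show n - (n - (k + 1) + 1) = k by omega] at h2
  have h3 := gromovProduct_add_gromovProduct (x k) (x (k + 1)) (x n)
  have h4 := hstep k hk
  have h5 := hX (x k) (x 0) (x n) (x (k + 1))
  rw [gromovProduct_comm] at h2
  rw [gromovProduct_comm (x k) (x n)] at h5
  by_contra! h
  have := lt_min h (show D + 2 * δ < gromovProduct (x k) (x (k + 1)) (x n) by linarith)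
  linarith

/-- A discrete intermediate value property. -/
lemma exists_le_le_add_of_step {f : ℕ → ℝ} {s M : ℝ} {n : ℕ} (hM : 0 ≤ M) (h0 : f 0 ≤ s)
    (hn : s ≤ f n) (hstep : ∀ k < n, f (k + 1) ≤ f k + M) : ∃ k ≤ n, s ≤ f k ∧ f k ≤ s + M := by
  classical
  have hex : ∃ k, s ≤ f k := ⟨n, hn⟩
  have hle := Nat.find_min' hex hn
  refine ⟨Nat.find hex, hle, Nat.find_spec hex, ?_⟩
  rcases hk : Nat.find hex with _ | k
  · linarith
  · have h1 := Nat.find_min hex (m := k) (by omega)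
    have h2 := hstep k (by omega)
    linarith

/-! ### Orbits of a single hyperbolic isometry -/

lemma dist_zpow_zpow (φ : X ≃ᵢ X) (o : X) (a b : ℤ) :
    dist ((φ ^ a) o) ((φ ^ b) o) = dist o ((φ ^ (b - a)) o) := by
  rw [← (φ ^ a).dist_eq o, ← IsometryEquiv.mul_apply, ← zpow_add, add_sub_cancel]

lemma dist_pow_pow_add (φ : X ≃ᵢ X) (o : X) (a b : ℕ) :
    dist ((φ ^ a) o) ((φ ^ (a + b)) o) = dist o ((φ ^ b) o) := by
  rw [pow_add, IsometryEquiv.mul_apply, (φ ^ a).dist_eq]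

lemma dist_pow_le (φ : X ≃ᵢ X) (o : X) (n : ℕ) : dist o ((φ ^ n) o) ≤ n * dist o (φ o) := by
  induction n with
  | zero => simp
  | succ n ih =>
    have h := dist_triangle o ((φ ^ n) o) ((φ ^ (n + 1)) o)
    rw [dist_pow_pow_add, pow_one] at h
    push_cast
    linarith

lemma dist_inv_apply (φ : X ≃ᵢ X) (o : X) : dist o (φ⁻¹ o) = dist o (φ o) := by
  rw [← φ.dist_eq o, IsometryEquiv.apply_inv_self, dist_comm]

/-- Whether an orbit map is a quasi-isometric embedding does not depend on the base point. -/
lemma IsHyperbolicIsometry.orbit {φ : X ≃ᵢ X} (h : IsHyperbolicIsometry φ) (o : X) :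
    IsQuasiIsometricEmbedding (fun n : ℤ => (φ ^ n) o) := by
  obtain ⟨x, L, A, hL, hA, h⟩ := h
  refine ⟨L, A + 2 * dist x o, hL, by positivity, fun s t => ?_⟩
  obtain ⟨h1, h2⟩ := h s t
  have e1 := (φ ^ s).dist_eq x o
  have e2 := (φ ^ t).dist_eq x o
  have t1 := dist_triangle4 ((φ ^ s) x) ((φ ^ s) o) ((φ ^ t) o) ((φ ^ t) x)
  have t2 := dist_triangle4 ((φ ^ s) o) ((φ ^ s) x) ((φ ^ t) x) ((φ ^ t) o)
  rw [dist_comm ((φ ^ t) o) ((φ ^ t) x)] at t1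
  rw [dist_comm ((φ ^ s) o) ((φ ^ s) x)] at t2
  constructor <;> linarith

lemma IsHyperbolicIsometry.inv {φ : X ≃ᵢ X} (h : IsHyperbolicIsometry φ) :
    IsHyperbolicIsometry φ⁻¹ := by
  obtain ⟨x, L, A, hL, hA, h⟩ := h
  refine ⟨x, L, A, hL, hA, fun s t => ?_⟩
  have := h (-s) (-t)
  rw [dist_neg_neg] at this
  simpa only [inv_zpow, ← zpow_neg] using this

lemma IsHyperbolicIsometry.exists_linear_le {φ : X ≃ᵢ X} (h : IsHyperbolicIsometry φ) (o : X) :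
    ∃ c A : ℝ, 0 < c ∧ ∀ n : ℕ, c * n - A ≤ dist o ((φ ^ n) o) := by
  obtain ⟨L, A, hL, hA, h⟩ := h.orbit o
  refine ⟨L⁻¹, A, by positivity, fun n => ?_⟩
  simpa [Int.dist_eq] using (h 0 n).1

lemma IsHyperbolicIsometry.exists_forall_le_dist_pow {φ : X ≃ᵢ X} (h : IsHyperbolicIsometry φ) (o : X) (R : ℝ) :
    ∃ B : ℕ, ∀ n, B ≤ n → R ≤ dist o ((φ ^ n) o) := by
  obtain ⟨c, A, hc, hA⟩ := h.exists_linear_le o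
  obtain ⟨B, hB⟩ := exists_nat_ge ((R + A) / c)
  refine ⟨B, fun n hn => ?_⟩
  have h1 := (div_le_iff₀ hc).1 (hB.trans (Nat.cast_le.2 hn))
  have h2 := hA n
  linarith

/-- Otherwise each doubling of the exponent adds less than `C`, so displacement along powers of two
grows only logarithmically in the exponent, against the linear lower bound. -/
lemma exists_dist_pow_add_le {φ : X ≃ᵢ X} {o : X} {c A : ℝ} (hc : 0 < c)
    (h : ∀ n : ℕ, c * n - A ≤ dist o ((φ ^ n) o)) (C : ℝ) :
    ∃ N : ℕ, dist o ((φ ^ N) o) + C ≤ dist o ((φ ^ (2 * N)) o) := by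
  by_contra! hcon
  have hk : ∀ k : ℕ, dist o ((φ ^ 2 ^ k) o) ≤ dist o (φ o) + k * C := by
    intro k
    induction k with
    | zero => simp
    | succ k ih =>
      have := hcon (2 ^ k)
      rw [pow_succ' 2 k]
      push_cast
      linarith
  have h0 := tendsto_pow_const_div_const_pow_of_one_lt 0 (one_lt_two (α := ℝ))
  have h1 := tendsto_pow_const_div_const_pow_of_one_lt 1 (one_lt_two (α := ℝ))
  have h2 := (h0.const_mul (A + dist o (φ o))).add (h1.const_mul C)
  simp only [mul_zero, add_zero] at h2
  obtain ⟨k, hk'⟩ := (h2.eventually (gt_mem_nhds hc)).exists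
  have h3 := h (2 ^ k)
  have h4 := hk k
  push_cast at h3
  rw [← mul_div_assoc, ← mul_div_assoc, ← add_div, div_lt_iff₀ (by positivity)] at hk'
  simp only [pow_zero, pow_one, mul_one] at hk'
  linarith

/-- The two ends of the axis of a hyperbolic isometry have bounded Gromov product. -/
lemma IsHyperbolicIsometry.exists_gromovProduct_inv_pow_le {δ : ℝ} (hX : FourPointCondition X δ)
    (hδ : 0 ≤ δ) {φ : X ≃ᵢ X} (h : IsHyperbolicIsometry φ) (o : X) :
    ∃ D : ℝ, ∀ m n : ℕ, gromovProduct o ((φ⁻¹ ^ m) o) ((φ ^ n) o) ≤ D := by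
  obtain ⟨c, A, hc, hcA⟩ := h.exists_linear_le o
  obtain ⟨N, hN⟩ := exists_dist_pow_add_le hc hcA (3 * δ + 1)
  have hN0 : 0 < N := by
    rcases Nat.eq_zero_or_pos N with rfl | h
    · simp at hN; linarith
    · exact h
  -- Here `2 * D` is twice the displacement of `φ ^ N` minus that of `φ ^ (2 * N)`, so the choice of
  -- `N` is what makes the pieces long relative to the corners.
  set D := gromovProduct o ((φ ^ (-N : ℤ)) o) ((φ ^ (N : ℤ)) o) with hD
  have hR : 2 * D + 3 * δ < dist o ((φ ^ N) o) := by
    have hneg : dist o ((φ ^ (-N : ℤ)) o) = dist o ((φ ^ N) o) := by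
      rw [dist_comm]; simpa using dist_zpow_zpow φ o (-N) 0
    rw [hD, gromovProduct, dist_zpow_zpow, hneg, zpow_natCast,
      show (N : ℤ) - -N = (2 * N : ℕ) by push_cast; ring, zpow_natCast]
    linarith
  refine ⟨D + 2 * δ + 3 * (N * dist o (φ o)), fun m n => ?_⟩
  -- The orbit is sampled at multiples of `N`, shifted so that corner `m / N` is `o`; the remainders
  -- modulo `N` cost a bounded amount.
  have key := gromovProduct_le_of_local (n := m / N + n / N) (k := m / N)
    (x := fun k => (φ ^ (((k : ℤ) - (m / N : ℕ)) * N)) o) hX hδ (gromovProduct_nonneg _ _ _) hR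
    (fun k _ => by
      rw [← gromovProduct_isometryEquiv (φ ^ ((((k + 1 : ℕ) : ℤ) - (m / N : ℕ)) * N)) o]
      simp only [← IsometryEquiv.mul_apply, ← zpow_add]
      apply le_of_eq
      congr 3 <;> push_cast <;> ring)
    (fun k _ => by
      rw [dist_zpow_zpow, ← zpow_natCast]
      apply le_of_eq
      congr 3
      push_cast; ring) (Nat.le_add_right _ _)
  have hmod : ∀ (ψ : X ≃ᵢ X) (l : ℕ), dist o (ψ o) = dist o (φ o) →
      dist ((ψ ^ l) o) ((ψ ^ (N * (l / N))) o) ≤ N * dist o (φ o) := by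
    intro ψ l hψ
    nth_rewrite 1 [← Nat.div_add_mod l N]
    rw [dist_comm, dist_pow_pow_add]
    refine (dist_pow_le ψ o _).trans ?_
    rw [hψ]
    have := (Nat.mod_lt l hN0).le
    gcongr
  have hm := hmod φ⁻¹ m (dist_inv_apply φ o)
  have hn := hmod φ n rfl
  have e1 : φ⁻¹ ^ (N * (m / N)) = φ ^ ((((0 : ℕ) : ℤ) - (m / N : ℕ)) * N) := by
    rw [← zpow_natCast, inv_zpow, ← zpow_neg]
    congr 1
    push_cast; ring
  have e2 : φ ^ (N * (n / N)) = φ ^ ((((m / N + n / N : ℕ) : ℤ) - (m / N : ℕ)) * N) := by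
    rw [← zpow_natCast]
    congr 1
    push_cast; ring
  rw [e1] at hm
  rw [e2] at hn
  have := gromovProduct_le_of_dist_le (w := o) (w' := o) (by rw [dist_self]; positivity) hm hn
  simp only [sub_self, zero_mul, zpow_zero, IsometryEquiv.coe_one, id] at key
  linarith

/-- Positive orbits of a hyperbolic isometry travel almost along geodesics. -/
lemma IsHyperbolicIsometry.exists_gromovProduct_pow_le {δ : ℝ} (hX : FourPointCondition X δ)
    (hδ : 0 ≤ δ) {φ : X ≃ᵢ X} (h : IsHyperbolicIsometry φ) (o : X) :
    ∃ D : ℝ, ∀ k m : ℕ, k ≤ m → gromovProduct ((φ ^ k) o) o ((φ ^ m) o) ≤ D := by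
  obtain ⟨D, hD⟩ := h.exists_gromovProduct_inv_pow_le hX hδ o
  refine ⟨D, fun k m hkm => ?_⟩
  have := hD k (m - k)
  rwa [← gromovProduct_isometryEquiv (φ ^ k), ← IsometryEquiv.mul_apply,
    ← IsometryEquiv.mul_apply, ← pow_add, Nat.add_sub_cancel' hkm, inv_pow, mul_inv_cancel] at this

/-! ### Endpoints at infinity -/

/-- If two almost geodesic sequences have unbounded Gromov product, then the first stays close
to the second. -/
lemma exists_dist_le_of_gromovProduct_unbounded {δ D M : ℝ} (hX : FourPointCondition X δ)
    (hM : 0 ≤ M) {a b : ℕ → X} {o : X} (ha0 : a 0 = o) (hb0 : b 0 = o)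
    (ha : ∀ k m, k ≤ m → gromovProduct (a k) o (a m) ≤ D)
    (hb : ∀ k m, k ≤ m → gromovProduct (b k) o (b m) ≤ D)
    (haM : ∀ k, dist (a k) (a (k + 1)) ≤ M) (hbM : ∀ k, dist (b k) (b (k + 1)) ≤ M)
    (hab : ∀ T : ℝ, ∃ m n, T < gromovProduct o (a m) (b n)) (hδ : 0 ≤ δ) (hD : 0 ≤ D) (k : ℕ) :
    ∃ j, dist (a k) (b j) ≤ M + 2 * D + 4 * δ := by
  have hlin : ∀ l : ℕ, dist o (a l) ≤ l * M := by
    intro l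
    induction l with
    | zero => simp [ha0]
    | succ l ih =>
      have h1 := dist_triangle o (a l) (a (l + 1))
      have h2 := haM l
      push_cast
      linarith
  -- The threshold `k * M` bounds `dist o (a k)`; it forces `k ≤ m` and makes `b n` at least as far
  -- from `o` as `a k`.
  obtain ⟨m, n, hmn⟩ := hab (k * M)
  have hkm : k ≤ m := by
    by_contra! hlt
    have h1 := gromovProduct_le_dist_left o (a m) (b n)
    have h2 := hlin m
    have h3 : (m : ℝ) * M ≤ k * M := by gcongr
    linarith
  have hn := gromovProduct_le_dist_right o (a m) (b n)
  have hk := hlin k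
  obtain ⟨j, hjn, hj1, hj2⟩ := exists_le_le_add_of_step (f := fun i => dist o (b i))
    (s := dist o (a k)) (n := n) hM (by simp [hb0]) (by linarith)
    (fun i _ => (dist_triangle o (b i) _).trans (by linarith [hbM i]))
  refine ⟨j, ?_⟩
  have g1 := gromovProduct_add_gromovProduct o (a k) (a m)
  have g2 := gromovProduct_add_gromovProduct o (b j) (b n)
  have g3 := ha k m hkm
  have g4 := hb j n hjn
  have f1 := hX o (a k) (a m) (b n)
  have f2 := hX o (a k) (b n) (b j)
  rw [gromovProduct_comm o (b n)] at f2
  -- Two four-point inequalities pass from `a k` to `b j` through `a m` and `b n`.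
  have i1 := le_min (show dist o (a k) - D ≤ gromovProduct o (a k) (a m) by linarith)
    (show dist o (a k) - D ≤ gromovProduct o (a m) (b n) by linarith)
  have i2 := le_min (show dist o (a k) - D - δ ≤ gromovProduct o (a k) (b n) by linarith)
    (show dist o (a k) - D - δ ≤ gromovProduct o (b j) (b n) by linarith)
  rw [dist_eq_sub_gromovProduct o]
  linarith

/-- The quasigeodesic ray `t ↦ φ^⌊t⌋ o` along the positive orbit of a hyperbolic isometry. -/
noncomputable def orbitRay (φ : X ≃ᵢ X) (h : IsHyperbolicIsometry φ) (o : X) :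
    QuasigeodesicRay X :=
  ⟨fun t => (φ ^ ⌊t⌋₊) o, by
    obtain ⟨L, A, hL, hA, h⟩ := h.orbit o
    refine ⟨L, A + L, hL, by positivity, fun s t => ?_⟩
    obtain ⟨h1, h2⟩ := h ⌊s⌋₊ ⌊t⌋₊
    simp only [zpow_natCast, Int.dist_eq, Int.cast_natCast] at h1 h2
    have s1 : ((⌊s⌋₊ : ℕ) : ℝ) ≤ s := by exact_mod_cast Nat.floor_le s.2
    have s2 : (s : ℝ) < ⌊s⌋₊ + 1 := by exact_mod_cast Nat.lt_floor_add_one s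
    have t1 : ((⌊t⌋₊ : ℕ) : ℝ) ≤ t := by exact_mod_cast Nat.floor_le t.2
    have t2 : (t : ℝ) < ⌊t⌋₊ + 1 := by exact_mod_cast Nat.lt_floor_add_one t
    have hL' : L⁻¹ ≤ L := (inv_le_one_of_one_le₀ hL).trans hL
    have hL0 : 0 < L⁻¹ := by positivity
    rw [NNReal.dist_eq]
    have a1 : |(s : ℝ) - t| ≤ |(⌊s⌋₊ : ℝ) - ⌊t⌋₊| + 1 := by
      rcases abs_cases ((s : ℝ) - t) with h | h <;>
        rcases abs_cases ((⌊s⌋₊ : ℝ) - ⌊t⌋₊) with h' | h' <;> linarith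
    have a2 : |(⌊s⌋₊ : ℝ) - ⌊t⌋₊| ≤ |(s : ℝ) - t| + 1 := by
      rcases abs_cases ((s : ℝ) - t) with h | h <;>
        rcases abs_cases ((⌊s⌋₊ : ℝ) - ⌊t⌋₊) with h' | h' <;> linarith
    have b1 := mul_le_mul_of_nonneg_left a1 hL0.le
    have b2 := mul_le_mul_of_nonneg_left a2 (zero_le_one.trans hL)
    constructor <;> linarith⟩

lemma range_orbitRay (φ : X ≃ᵢ X) (h : IsHyperbolicIsometry φ) (o : X) :
    Set.range (orbitRay φ h o).1 = Set.range fun n : ℕ => (φ ^ n) o := by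
  ext y
  constructor
  · rintro ⟨t, rfl⟩
    exact ⟨⌊t⌋₊, rfl⟩
  · rintro ⟨n, rfl⟩
    exact ⟨n, by simp [orbitRay]⟩

lemma hausdorffEDist_lt_top_of_dist_le {s t : Set X} {C : ℝ}
    (hs : ∀ x ∈ s, ∃ y ∈ t, dist x y ≤ C) (ht : ∀ y ∈ t, ∃ x ∈ s, dist y x ≤ C) :
    Metric.hausdorffEDist s t < ⊤ := by
  have key : ∀ x y : X, dist x y ≤ C → edist x y ≤ ENNReal.ofReal C := fun x y h => by
    rw [edist_dist]; exact ENNReal.ofReal_le_ofReal h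
  refine lt_of_le_of_lt (Metric.hausdorffEDist_le_of_mem_edist (r := ENNReal.ofReal C)
    (fun x hx => ?_) fun y hy => ?_) ENNReal.ofReal_lt_top
  · obtain ⟨y, hy, h⟩ := hs x hx
    exact ⟨y, hy, key _ _ h⟩
  · obtain ⟨x, hx, h⟩ := ht y hy
    exact ⟨x, hx, key _ _ h⟩

/-- The positive end of a hyperbolic isometry is fixed by it. -/
lemma orbitRay_mem_boundaryFixedPoints (φ : X ≃ᵢ X) (h : IsHyperbolicIsometry φ) (o : X) :
    (Quotient.mk _ (orbitRay φ h o) : GromovBoundary X) ∈ boundaryFixedPoints φ := by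
  apply Quotient.sound
  change Metric.hausdorffEDist (Set.range (φ ∘ (orbitRay φ h o).1)) _ < ⊤
  rw [Set.range_comp, range_orbitRay]
  have hd : ∀ n : ℕ, dist ((φ ^ n) o) (φ ((φ ^ n) o)) ≤ dist o (φ o) := fun n => by
    rw [← IsometryEquiv.mul_apply, ← pow_succ', dist_pow_pow_add, pow_one]
  refine hausdorffEDist_lt_top_of_dist_le (C := dist o (φ o)) ?_ ?_
  · rintro _ ⟨_, ⟨n, rfl⟩, rfl⟩
    exact ⟨_, ⟨n, rfl⟩, by rw [dist_comm]; exact hd n⟩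
  · rintro _ ⟨n, rfl⟩
    exact ⟨_, ⟨_, ⟨n, rfl⟩, rfl⟩, hd n⟩

/-- Applied also to `φ⁻¹`, this shows that a letter and its inverse fix the same boundary points. -/
lemma boundaryFixedPoints_subset_inv (φ : X ≃ᵢ X) :
    boundaryFixedPoints φ ⊆ boundaryFixedPoints φ⁻¹ := by
  intro a ha
  have hinv : ∀ a, GromovBoundary.map φ⁻¹ (GromovBoundary.map φ a) = a := by
    intro a
    induction a using Quotient.ind with
    | _ ρ =>
      apply congrArg (Quotient.mk _)
      apply Subtype.ext
      funext t
      exact φ.inv_apply_self _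
  have ha' : GromovBoundary.map φ a = a := ha
  have := hinv a
  rwa [ha'] at this

/-- Hyperbolic isometries without a common fixed point at infinity have positive orbits with
bounded Gromov product. -/
lemma exists_gromovProduct_pow_pow_le {δ : ℝ} (hX : FourPointCondition X δ) (hδ : 0 ≤ δ)
    {φ ψ : X ≃ᵢ X} (hφ : IsHyperbolicIsometry φ) (hψ : IsHyperbolicIsometry ψ)
    (hfix : Disjoint (boundaryFixedPoints φ) (boundaryFixedPoints ψ)) (o : X) :
    ∃ D : ℝ, ∀ m n : ℕ, gromovProduct o ((φ ^ m) o) ((ψ ^ n) o) ≤ D := by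
  -- Unbounded products make the two orbits fellow-travel, so both rays define one boundary point,
  -- fixed by `φ` and by `ψ`.
  by_contra! hcon
  obtain ⟨D₁, hD₁⟩ := hφ.exists_gromovProduct_pow_le hX hδ o
  obtain ⟨D₂, hD₂⟩ := hψ.exists_gromovProduct_pow_le hX hδ o
  set D := max D₁ D₂
  set M := max (dist o (φ o)) (dist o (ψ o))
  have hM : 0 ≤ M := dist_nonneg.trans (le_max_left _ _)
  have hD : 0 ≤ D :=
    ((gromovProduct_nonneg _ _ _).trans (hD₁ 0 0 le_rfl)).trans (le_max_left _ _)
  have ha := fun k m hkm => (hD₁ k m hkm).trans (le_max_left D₁ D₂)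
  have hb := fun k m hkm => (hD₂ k m hkm).trans (le_max_right D₁ D₂)
  have haM : ∀ k, dist ((φ ^ k) o) ((φ ^ (k + 1)) o) ≤ M := fun k => by
    rw [dist_pow_pow_add, pow_one]; exact le_max_left _ _
  have hbM : ∀ k, dist ((ψ ^ k) o) ((ψ ^ (k + 1)) o) ≤ M := fun k => by
    rw [dist_pow_pow_add, pow_one]; exact le_max_right _ _
  refine Set.disjoint_left.1 hfix (orbitRay_mem_boundaryFixedPoints φ hφ o) ?_
  have heq : (Quotient.mk _ (orbitRay φ hφ o) : GromovBoundary X) =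
      Quotient.mk _ (orbitRay ψ hψ o) := by
    apply Quotient.sound
    change Metric.hausdorffEDist _ _ < ⊤
    rw [range_orbitRay, range_orbitRay]
    refine hausdorffEDist_lt_top_of_dist_le (C := M + 2 * D + 4 * δ) ?_ ?_
    · rintro _ ⟨k, rfl⟩
      obtain ⟨j, hj⟩ := exists_dist_le_of_gromovProduct_unbounded (a := fun n => (φ ^ n) o)
        (b := fun n => (ψ ^ n) o) hX hM rfl rfl ha hb haM hbM hcon hδ hD k
      exact ⟨_, ⟨j, rfl⟩, hj⟩
    · rintro _ ⟨k, rfl⟩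
      obtain ⟨j, hj⟩ := exists_dist_le_of_gromovProduct_unbounded (a := fun n => (ψ ^ n) o)
        (b := fun n => (φ ^ n) o) hX hM rfl rfl hb ha hbM haM
        (fun T => by
          obtain ⟨m, n, h⟩ := hcon T
          exact ⟨n, m, by rwa [gromovProduct_comm]⟩) hδ hD k
      exact ⟨_, ⟨j, rfl⟩, hj⟩
  rw [heq]
  exact orbitRay_mem_boundaryFixedPoints ψ hψ o

/-! ### Reduced words as broken geodesics -/

/-- The isometry `a i` or its inverse, according to a letter of the free group. -/
def letterIsometry {α : Type*} (a : α → X ≃ᵢ X) (c : α × Bool) : X ≃ᵢ X :=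
  cond c.2 (a c.1) (a c.1)⁻¹

/-- The isometry represented by the prefix of length `k` of a word. -/
def prefixIsometry {α : Type*} (a : α → X ≃ᵢ X) (w : List (α × Bool)) (k : ℕ) : X ≃ᵢ X :=
  ((w.take k).map (letterIsometry a)).prod

lemma letterIsometry_not {α : Type*} (a : α → X ≃ᵢ X) (i : α) (b : Bool) :
    letterIsometry a (i, !b) = (letterIsometry a (i, b))⁻¹ := by
  cases b <;> simp [letterIsometry]

lemma letterIsometry_pow {α : Type*} (a : α → X ≃ᵢ X) (β : α → ℕ) (c : α × Bool) :
    letterIsometry (fun i => a i ^ β i) c = letterIsometry a c ^ β c.1 := by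
  rcases c with ⟨i, _ | _⟩ <;> simp [letterIsometry]

lemma prefixIsometry_succ {α : Type*} (a : α → X ≃ᵢ X) (w : List (α × Bool)) {k : ℕ}
    (hk : k < w.length) :
    prefixIsometry a w (k + 1) = prefixIsometry a w k * letterIsometry a w[k] := by
  rw [prefixIsometry, List.take_add_one, List.getElem?_eq_getElem hk, List.map_append,
    List.prod_append]
  simp [prefixIsometry]

lemma prefixIsometry_zero {α : Type*} (a : α → X ≃ᵢ X) (w : List (α × Bool)) :
    prefixIsometry a w 0 = 1 := by
  simp [prefixIsometry]

lemma prefixIsometry_mem_range {α : Type*} (a : α → X ≃ᵢ X) (w : List (α × Bool)) (k : ℕ) :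
    prefixIsometry a w k ∈ (FreeGroup.lift a).range :=
  ⟨FreeGroup.mk (w.take k), FreeGroup.lift_mk⟩

lemma prefixIsometry_toWord_length {α : Type*} [DecidableEq α] (a : α → X ≃ᵢ X)
    (u : FreeGroup α) :
    prefixIsometry a u.toWord u.toWord.length = FreeGroup.lift a u := by
  conv_rhs => rw [← FreeGroup.mk_toWord (x := u), FreeGroup.lift_mk]
  rw [prefixIsometry, List.take_length]
  rfl

lemma dist_prefixIsometry_succ {α : Type*} (a : α → X ≃ᵢ X) (w : List (α × Bool)) (p : X) {k : ℕ}
    (hk : k < w.length) :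
    dist (prefixIsometry a w k p) (prefixIsometry a w (k + 1) p) =
      dist p (letterIsometry a w[k] p) := by
  rw [prefixIsometry_succ a w hk, IsometryEquiv.mul_apply, IsometryEquiv.dist_eq]

section PingPong

variable {α : Type*} [DecidableEq α] {δ D R : ℝ} {o : X} {a : α → X ≃ᵢ X}

/-- Translating the corner to `o` turns its neighbours into the images of `o` under the inverse of
one letter and under the next letter. These letters differ because the word is reduced. -/
lemma gromovProduct_prefixIsometry_le
    (hangle : ∀ c c', c ≠ c' →
      gromovProduct o (letterIsometry a c o) (letterIsometry a c' o) ≤ D)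
    (u : FreeGroup α) (k : ℕ) (hk : k + 2 ≤ u.toWord.length) :
    gromovProduct (prefixIsometry a u.toWord (k + 1) o) (prefixIsometry a u.toWord k o)
      (prefixIsometry a u.toWord (k + 2) o) ≤ D := by
  have hred := List.isChain_iff_getElem.1 (FreeGroup.isReduced_toWord (x := u)) k (by omega)
  rw [prefixIsometry_succ a _ (show k + 1 < u.toWord.length by omega),
    IsometryEquiv.mul_apply,
    show prefixIsometry a u.toWord k =
      prefixIsometry a u.toWord (k + 1) * (letterIsometry a u.toWord[k])⁻¹ by
      rw [prefixIsometry_succ a _ (show k < u.toWord.length by omega), mul_inv_cancel_right],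
    IsometryEquiv.mul_apply, gromovProduct_isometryEquiv]
  rw [← letterIsometry_not]
  refine hangle _ _ fun h => ?_
  rw [← h] at hred
  simpa using hred rfl

lemma length_mul_le_dist_lift (hX : FourPointCondition X δ) (hδ : 0 ≤ δ) (hD : 0 ≤ D)
    (hR : 2 * D + 3 * δ < R)
    (hangle : ∀ c c', c ≠ c' →
      gromovProduct o (letterIsometry a c o) (letterIsometry a c' o) ≤ D)
    (hstep : ∀ c, R ≤ dist o (letterIsometry a c o)) (u : FreeGroup α) :
    u.toWord.length * (R - 2 * D - 2 * δ) ≤ dist o (FreeGroup.lift a u o) := by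
  have := mul_le_dist_of_local (x := fun k => prefixIsometry a u.toWord k o) hX hδ hD hR
    (gromovProduct_prefixIsometry_le hangle u)
    (fun k hk => (hstep _).trans_eq (dist_prefixIsometry_succ a _ o hk).symm) le_rfl
  simpa only [prefixIsometry_zero, prefixIsometry_toWord_length, IsometryEquiv.coe_one,
    id] using this

lemma injective_lift_of_pingPong (hX : FourPointCondition X δ) (hδ : 0 ≤ δ) (hD : 0 ≤ D)
    (hR : 2 * D + 3 * δ < R)
    (hangle : ∀ c c', c ≠ c' →
      gromovProduct o (letterIsometry a c o) (letterIsometry a c' o) ≤ D)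
    (hstep : ∀ c, R ≤ dist o (letterIsometry a c o)) :
    Function.Injective (FreeGroup.lift a) := by
  rw [injective_iff_map_eq_one]
  intro u hu
  have := length_mul_le_dist_lift hX hδ hD hR hangle hstep u
  rw [hu, IsometryEquiv.coe_one, id, dist_self] at this
  have h0 : ((u.toWord.length : ℕ) : ℝ) ≤ 0 := by
    by_contra! h
    have := mul_pos h (show 0 < R - 2 * D - 2 * δ by linarith)
    linarith
  rw [← FreeGroup.toWord_eq_nil_iff, ← List.length_eq_zero_iff]
  exact_mod_cast h0.antisymm (Nat.cast_nonneg _)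

lemma finite_range_lift_of_pingPong [Finite α] (hX : FourPointCondition X δ) (hδ : 0 ≤ δ)
    (hD : 0 ≤ D) (hR : 2 * D + 3 * δ < R)
    (hangle : ∀ c c', c ≠ c' →
      gromovProduct o (letterIsometry a c o) (letterIsometry a c' o) ≤ D)
    (hstep : ∀ c, R ≤ dist o (letterIsometry a c o)) (p : X) (r : ℝ) :
    {g : X ≃ᵢ X | g ∈ (FreeGroup.lift a).range ∧ dist p (g p) ≤ r}.Finite := by
  set η := R - 2 * D - 2 * δ with hη
  have hη0 : 0 < η := by rw [hη]; linarith
  obtain ⟨n, hn⟩ := exists_nat_ge ((r + 2 * dist o p) / η)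
  refine ((List.finite_length_le (α × Bool) n).image
    fun w => FreeGroup.lift a (FreeGroup.mk w)).subset ?_
  rintro _ ⟨⟨u, rfl⟩, hu⟩
  refine ⟨u.toWord, ?_, by simp only [FreeGroup.mk_toWord]⟩
  have h1 := length_mul_le_dist_lift hX hδ hD hR hangle hstep u
  have h2 := dist_triangle4 o p (FreeGroup.lift a u p) (FreeGroup.lift a u o)
  rw [IsometryEquiv.dist_eq, dist_comm p o] at h2
  have hu' : dist p (FreeGroup.lift a u p) ≤ r := hu
  have h3 : (u.toWord.length : ℝ) * η ≤ r + 2 * dist o p := by linarith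
  exact_mod_cast ((le_div_iff₀ hη0).2 h3).trans hn

/-- The prefixes of `u⁻¹ * v` give an orbit path with bounded jumps between the endpoints of the
geodesic, which passes near each of its points. The path point about as far from the start as `z` is
then close to `z`. -/
lemma isQuasiconvex_orbit_of_pingPong [Finite α] {δ' : ℝ} (hgeo : IsGeodesicSpace X)
    (hslim : ∀ (x y z : X) (a b c : Set X),
      IsGeodesicSegment a x y → IsGeodesicSegment b y z → IsGeodesicSegment c z x →
        a ⊆ Metric.thickening δ' (b ∪ c)) (hδ' : 0 < δ')
    (hX : FourPointCondition X δ) (hδ : 0 ≤ δ) (hD : 0 ≤ D) (hR : 2 * D + 3 * δ < R)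
    (hangle : ∀ c c', c ≠ c' →
      gromovProduct o (letterIsometry a c o) (letterIsometry a c' o) ≤ D)
    (hstep : ∀ c, R ≤ dist o (letterIsometry a c o)) (p : X) :
    IsQuasiconvex ((fun g : X ≃ᵢ X => g p) '' ((FreeGroup.lift a).range : Set (X ≃ᵢ X))) := by
  obtain ⟨M₀, hM₀⟩ := (Set.finite_range fun c => dist p (letterIsometry a c p)).bddAbove
  set M := max M₀ 0
  have hM : ∀ c, dist p (letterIsometry a c p) ≤ M := fun c =>
    (hM₀ ⟨c, rfl⟩).trans (le_max_left _ _)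
  -- The terms are the corner bound at `o`, the change of base point to `p`, and the passage from
  -- Gromov product to distance from the geodesic.
  set E := D + 2 * δ + 3 * dist p o + 2 * δ' with hE
  refine ⟨M + 2 * E, ?_⟩
  rintro _ ⟨_, ⟨u, rfl⟩, rfl⟩ _ ⟨_, ⟨v, rfl⟩, rfl⟩ T hT z hz
  set w := (u⁻¹ * v).toWord with hw
  set y : ℕ → X := fun k => FreeGroup.lift a u (prefixIsometry a w k p) with hy
  have hy0 : y 0 = FreeGroup.lift a u p := by
    simp [hy, prefixIsometry_zero]
  have hyn : y w.length = FreeGroup.lift a v p := by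
    simp only [hy, hw, prefixIsometry_toWord_length]
    rw [← IsometryEquiv.mul_apply, ← map_mul, mul_inv_cancel_left]
  have hgp : ∀ k ≤ w.length, gromovProduct (y k) (y 0) (y w.length) + 2 * δ' ≤ E := by
    intro k hk
    have h1 := gromovProduct_le_of_local (x := fun k => prefixIsometry a w k o) hX hδ hD hR
      (gromovProduct_prefixIsometry_le hangle (u⁻¹ * v))
      (fun k hk => (hstep _).trans_eq (dist_prefixIsometry_succ a _ o hk).symm) hk
    have hd : ∀ k, dist (prefixIsometry a w k p) (prefixIsometry a w k o) ≤ dist p o :=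
      fun k => (IsometryEquiv.dist_eq _ _ _).le
    have h2 := gromovProduct_le_of_dist_le (hd k) (hd 0) (hd w.length)
    rw [gromovProduct_isometryEquiv]
    linarith
  have hz' := hT.dist_add_dist hz
  obtain ⟨k, hk, hk1, hk2⟩ := exists_le_le_add_of_step (f := fun k => dist (y 0) (y k))
    (s := dist (y 0) z) (n := w.length) (le_max_right M₀ 0) (by simp)
    (by rw [hy0, hyn]; linarith [dist_nonneg (x := z) (y := FreeGroup.lift a v p)])
    (fun k hk => by
      refine (dist_triangle _ (y k) _).trans ?_
      have := (dist_prefixIsometry_succ a w p hk).trans_le (hM _)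
      rw [← (FreeGroup.lift a u).dist_eq] at this
      linarith)
  refine ⟨y k, ⟨FreeGroup.lift a u * prefixIsometry a w k, mul_mem ⟨u, rfl⟩
    (prefixIsometry_mem_range a w k), rfl⟩, ?_⟩
  have hTy : IsGeodesicSegment T (y 0) (y w.length) := by rw [hy0, hyn]; exact hT
  obtain ⟨q, hq, hqd⟩ := hTy.exists_dist_le hgeo hslim hδ' (y k)
  have hqE := hqd.trans (hgp k hk)
  have hzq : dist z q = |dist (y 0) z - dist (y 0) q| := by
    obtain ⟨γ, h0, -, h, rfl⟩ := hTy
    obtain ⟨s, hs, rfl⟩ := hz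
    obtain ⟨t, ht, rfl⟩ := hq
    have h00 : (0 : ℝ) ∈ Set.Icc 0 (dist (y 0) (y w.length)) := ⟨le_rfl, dist_nonneg⟩
    have e1 := h 0 h00 s hs
    have e2 := h 0 h00 t ht
    rw [h0, zero_sub, abs_neg, abs_of_nonneg hs.1] at e1
    rw [h0, zero_sub, abs_neg, abs_of_nonneg ht.1] at e2
    rw [h s hs t ht, e1, e2]
  have t1 := dist_triangle z q (y k)
  have t2 := abs_dist_sub_le (y k) q (y 0)
  rw [dist_comm (y k) (y 0), dist_comm q (y 0)] at t2
  rw [dist_comm q (y k)] at t1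
  have t3 : |dist (y 0) z - dist (y 0) q| ≤ M + E := by
    rw [abs_le] at t2 ⊢
    constructor <;> linarith
  linarith

end PingPong

end CoarseGeometry

/-! ### Choice of the exponents -/

theorem mainTheorem5 {X : Type*} [MetricSpace X]
    (hgeo : CoarseGeometry.IsGeodesicSpace X) (hhyp : CoarseGeometry.IsGromovHyperbolic X)
    (K : ℕ) (φ : Fin K → X ≃ᵢ X)
    (hφ : ∀ i, CoarseGeometry.IsHyperbolicIsometry (φ i))
    (hfix : ∀ i j, i ≠ j →
      Disjoint (CoarseGeometry.boundaryFixedPoints (φ i))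
        (CoarseGeometry.boundaryFixedPoints (φ j))) :
    ∃ B : ℕ, 1 ≤ B ∧ ∀ β : Fin K → ℕ, (∀ i, B ≤ β i) →
      Function.Injective (FreeGroup.lift (fun i => φ i ^ β i)) ∧
      CoarseGeometry.IsConvexCocompact
        (Subgroup.closure (Set.range (fun i => φ i ^ β i))) := by
  classical
  open CoarseGeometry in
  rcases isEmpty_or_nonempty X with hX | ⟨⟨o⟩⟩
  · obtain rfl : K = 0 := by
      rcases K with _ | K
      · rfl
      · exact isEmptyElim (hφ 0).choose
    have : Subsingleton (X ≃ᵢ X) := ⟨fun f g => IsometryEquiv.ext fun x => isEmptyElim x⟩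
    exact ⟨1, le_rfl, fun β _ => ⟨Function.injective_of_subsingleton _,
      (Subgroup.fg_iff _).2 ⟨_, rfl, Set.finite_range _⟩, fun p => isEmptyElim p,
      fun p => isEmptyElim p⟩⟩
  obtain ⟨δ', hδ', hslim⟩ := hhyp
  have hX := fourPointCondition_of_slim hgeo hslim hδ'
  have hδ : 0 ≤ 3 * δ' := by positivity
  have hψ : ∀ c, IsHyperbolicIsometry (letterIsometry φ c) := by
    rintro ⟨i, _ | _⟩
    exacts [(hφ i).inv, hφ i]
  have hψfix : ∀ c, boundaryFixedPoints (letterIsometry φ c) = boundaryFixedPoints (φ c.1) := by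
    rintro ⟨i, _ | _⟩
    · refine Set.Subset.antisymm ?_ (boundaryFixedPoints_subset_inv _)
      simpa [letterIsometry] using boundaryFixedPoints_subset_inv (φ i)⁻¹
    · rfl
  have hbound : ∀ e : (Fin K × Bool) × (Fin K × Bool), ∃ D : ℝ, e.1 ≠ e.2 → ∀ m n : ℕ,
      gromovProduct o ((letterIsometry φ e.1 ^ m) o) ((letterIsometry φ e.2 ^ n) o) ≤ D := by
    rintro ⟨⟨i, b⟩, ⟨j, b'⟩⟩
    by_cases hij : i = j
    · subst hij
      by_cases hb : b = b'
      · exact ⟨0, fun h => absurd (by rw [hb]) h⟩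
      · obtain rfl : b = !b' := by cases b <;> cases b' <;> simp_all
        obtain ⟨D, hD⟩ := (hψ (i, b')).exists_gromovProduct_inv_pow_le hX hδ o
        exact ⟨D, fun _ => by rwa [letterIsometry_not]⟩
    · obtain ⟨D, hD⟩ := exists_gromovProduct_pow_pow_le hX hδ (hψ (i, b)) (hψ (j, b'))
        (by rw [hψfix, hψfix]; exact hfix i j hij) o
      exact ⟨D, fun _ => hD⟩
  choose D₀ hD₀ using hbound
  obtain ⟨D₁, hD₁⟩ := (Set.finite_range D₀).bddAbove
  set D := max D₁ 0
  have hD : ∀ c c', c ≠ c' → ∀ m n : ℕ,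
      gromovProduct o ((letterIsometry φ c ^ m) o) ((letterIsometry φ c' ^ n) o) ≤ D :=
    fun c c' h m n => (hD₀ (c, c') h m n).trans ((hD₁ ⟨_, rfl⟩).trans (le_max_left _ _))
  have hD0 : 0 ≤ D := le_max_right _ _
  have hR : 2 * D + 3 * (3 * δ') < 2 * D + 3 * (3 * δ') + 1 := lt_add_one _
  choose B₀ hB₀ using fun c => (hψ c).exists_forall_le_dist_pow o (2 * D + 3 * (3 * δ') + 1)
  obtain ⟨B, hB⟩ := (Set.finite_range B₀).bddAbove
  -- `D` was fixed for all exponents at once, so `B` only has to make every letter move `o` far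
  -- enough.
  refine ⟨max B 1, le_max_right _ _, fun β hβ => ?_⟩
  have hangle : ∀ c c', c ≠ c' → gromovProduct o (letterIsometry (fun i => φ i ^ β i) c o)
      (letterIsometry (fun i => φ i ^ β i) c' o) ≤ D := fun c c' h => by
    rw [letterIsometry_pow, letterIsometry_pow]
    exact hD c c' h _ _
  have hstep : ∀ c, 2 * D + 3 * (3 * δ') + 1 ≤
      dist o (letterIsometry (fun i => φ i ^ β i) c o) := fun c => by
    rw [letterIsometry_pow]
    exact hB₀ c _ ((hB ⟨c, rfl⟩).trans ((le_max_left _ _).trans (hβ c.1)))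
  refine ⟨injective_lift_of_pingPong hX hδ hD0 hR hangle hstep,
    (Subgroup.fg_iff _).2 ⟨_, rfl, Set.finite_range _⟩, fun p r => ?_, fun p => ?_⟩
  · rw [← FreeGroup.range_lift_eq_closure]
    exact finite_range_lift_of_pingPong hX hδ hD0 hR hangle hstep p r
  · rw [← FreeGroup.range_lift_eq_closure]
    exact isQuasiconvex_orbit_of_pingPong hgeo hslim hδ' hX hδ hD0 hR hangle hstep p
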